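/- Let $X$ be a finite set and let $G$ be a $2$-transitive group of permutations of $X$, i.e. for all $a\ne b$ and $c\ne d$ in $X$ there is $g\in G$ with $g(a)=c$ and $g(b)=d$. Let $\overline G$ be the monoid, under composition, consisting of the elements of $G$ together with all constant maps $X\to X$. Let $k$ be an algebraically closed field of characteristic $0$. Then the monoid algebra $k\overline G$ is of finite representation type, i.e. up to isomorphism there are only finitely many indecomposable finitely generated (equivalently, finite-dimensional) $k\overline G$-modules. -/

import Mathlib

universe u v

/-- The monoid of self-maps of `X` consisting of the permutations in `G` together with all
constant maps; the product is composition of maps, `(f * g) x = f (g x)`. -/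
def adjoinConstants {X : Type u} (G : Subgroup (Equiv.Perm X)) : Submonoid (Function.End X) where
  carrier := {f | (∃ g ∈ G, f = (g : X → X)) ∨ ∃ x : X, f = Function.const X x}
  one_mem' := Or.inl ⟨1, G.one_mem, rfl⟩
  mul_mem' := by
    rintro _ _ (⟨g, hg, rfl⟩ | ⟨x, rfl⟩) (⟨h, hh, rfl⟩ | ⟨y, rfl⟩)
    · exact Or.inl ⟨g * h, G.mul_mem hg hh, rfl⟩
    · exact Or.inr ⟨g y, rfl⟩
    · exact Or.inr ⟨x, rfl⟩
    · exact Or.inr ⟨x, rfl⟩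

/-- A module is indecomposable if it is nonzero and is not the internal direct sum of two nonzero
submodules. -/
def IsIndecomposableModule (A : Type u) [Ring A] (M : Type v) [AddCommGroup M] [Module A M] :
    Prop :=
  Nontrivial M ∧ ∀ p q : Submodule A M, IsCompl p q → p = ⊥ ∨ q = ⊥

/-- Finite representation type: up to isomorphism there are only finitely many finitely generated
indecomposable (left) modules. For `A` a finite-dimensional algebra over a field, a module is
finitely generated if and only if it is finite-dimensional. Every finitely generated module is a
quotient of some `Fin n → A`, so modules in the universe of `A` represent all of them. -/
def IsOfFiniteRepresentationType (A : Type u) [Ring A] : Prop :=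
  ∃ (m : ℕ) (F : Fin m → ModuleCat.{u} A),
    ∀ (M : Type u) [AddCommGroup M] [Module A M],
      Module.Finite A M → IsIndecomposableModule A M → ∃ i, Nonempty (M ≃ₗ[A] F i)

open MonoidAlgebra

/-! ### Finitely many simple modules -/

section SimpleModules

/-! Write `c_x` for the constant map at `x`; then `c_x s = c_x` for all `s`, and `g c_x = c_{gx}`
for `g` in `G`. If all `c_x` act alike on an indecomposable `M`, their common action is an
idempotent endomorphism, hence `0` or `1`. Averaging over `G` then splits every submodule, so `M` is
simple, and an Artinian ring has finitely many simple modules. Otherwise `c_x w ≠ c_y w` for some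
`w`, and `M` is isomorphic to the single module `constIdeal`: a multiple of `b ↦ b w` embeds this
ideal in `M`, and `exists_map_to_constIdeal` supplies a retraction. The retraction exists because
2-transitivity forces an invariant `X × X` matrix to have the form `αI + βJ`, with `J` the all-ones
matrix. -/

theorem IsFiniteLength.exists_list_simple {A : Type u} [Ring A] {P : Type u} [AddCommGroup P]
    [Module A P] (h : IsFiniteLength A P) :
    ∃ L : List (ModuleCat.{u} A), ∀ (M : Type u) [AddCommGroup M] [Module A M],
      IsSimpleModule A M → ∀ f : P →ₗ[A] M, f ≠ 0 → ∃ N ∈ L, Nonempty (M ≃ₗ[A] N) := by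
  induction h with
  | of_subsingleton =>
    refine ⟨[], fun M _ _ _ f hf => (hf ?_).elim⟩
    exact LinearMap.ext fun x => by rw [Subsingleton.elim x 0, map_zero, map_zero]
  | @of_simple_quotient P _ _ N hN _ ih =>
    obtain ⟨L, hL⟩ := ih
    refine ⟨ModuleCat.of A (P ⧸ N) :: L, fun M _ _ hM f hf => ?_⟩
    -- Either `f` factors through the simple module `P ⧸ N` and Schur's lemma applies, or its
    -- restriction to `N` is nonzero.
    by_cases hfN : f ∘ₗ N.subtype = 0
    · have hle : N ≤ LinearMap.ker f := fun x hx => LinearMap.congr_fun hfN ⟨x, hx⟩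
      have hne : N.liftQ f hle ≠ 0 := fun h0 => hf <| by
        rw [← N.liftQ_mkQ f hle, h0, LinearMap.zero_comp]
      exact ⟨_, List.mem_cons_self,
        ⟨(LinearEquiv.ofBijective _ (LinearMap.bijective_of_ne_zero hne)).symm⟩⟩
    · obtain ⟨K, hK, e⟩ := hL M hM _ hfN
      exact ⟨K, List.mem_cons_of_mem _ hK, e⟩

theorem IsArtinianRing.exists_list_simple (A : Type u) [Ring A] [IsArtinianRing A] :
    ∃ L : List (ModuleCat.{u} A), ∀ (M : Type u) [AddCommGroup M] [Module A M],
      IsSimpleModule A M → ∃ N ∈ L, Nonempty (M ≃ₗ[A] N) := by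
  obtain ⟨L, hL⟩ := (isFiniteLength_iff_isNoetherian_isArtinian.mpr
    ⟨inferInstance, inferInstance⟩ : IsFiniteLength A A).exists_list_simple
  refine ⟨L, fun M _ _ hM => ?_⟩
  have := IsSimpleModule.nontrivial A M
  obtain ⟨m, hm⟩ := exists_ne (0 : M)
  refine hL M hM (LinearMap.toSpanSingleton A M m) fun h => hm ?_
  simpa using LinearMap.congr_fun h 1

/-- A list containing every indecomposable module up to isomorphism exhibits finite
representation type. -/
theorem IsOfFiniteRepresentationType.of_list {A : Type u} [Ring A] (L : List (ModuleCat.{u} A))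
    (h : ∀ (M : Type u) [AddCommGroup M] [Module A M], IsIndecomposableModule A M →
      ∃ N ∈ L, Nonempty (M ≃ₗ[A] N)) : IsOfFiniteRepresentationType A := by
  refine ⟨L.length, L.get, fun M _ _ _ hM => ?_⟩
  obtain ⟨N, hN, e⟩ := h M hM
  obtain ⟨i, rfl⟩ := List.get_of_mem hN
  exact ⟨i, e⟩

theorem IsIndecomposableModule.isSimpleModule {A : Type u} [Ring A] {M : Type v} [AddCommGroup M]
    [Module A M] (hM : IsIndecomposableModule A M)
    (h : ∀ p : Submodule A M, ∃ q, IsCompl p q) : IsSimpleModule A M := by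
  have := hM.1
  refine (isSimpleModule_iff A M).mpr { eq_bot_or_eq_top := fun p => ?_ }
  obtain ⟨q, hq⟩ := h p
  refine (hM.2 p q hq).imp_right fun h0 => ?_
  simpa [h0] using hq.sup_eq_top

end SimpleModules

/-! ### Action of permutations and constants -/

namespace adjoinConstants

variable {k : Type u} [Field k] {X : Type v} {G : Subgroup (Equiv.Perm X)}

/-- A permutation in `G` as an element of the monoid. -/
def perm (g : G) : adjoinConstants G := ⟨((g : Equiv.Perm X) : X → X), Or.inl ⟨g, g.2, rfl⟩⟩

/-- A constant map as an element of the monoid. -/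
def const (G : Subgroup (Equiv.Perm X)) (x : X) : adjoinConstants G :=
  ⟨Function.const X x, Or.inr ⟨x, rfl⟩⟩

theorem eq_perm_or_const (s : adjoinConstants G) : (∃ g, s = perm g) ∨ ∃ x, s = const G x := by
  obtain ⟨_, ⟨g, hg, rfl⟩ | ⟨x, rfl⟩⟩ := s
  exacts [Or.inl ⟨⟨g, hg⟩, rfl⟩, Or.inr ⟨x, rfl⟩]

theorem perm_mul_perm (g h : G) : perm g * perm h = perm (g * h) := rfl

theorem perm_one : perm (1 : G) = 1 := rfl

theorem const_mul (x : X) (s : adjoinConstants G) : const G x * s = const G x := rfl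

theorem perm_mul_const (g : G) (x : X) : perm g * const G x = const G (g • x) := rfl

variable {M : Type*} [AddCommGroup M] [Module k M] [Module k[adjoinConstants G] M]
  [IsScalarTower k k[adjoinConstants G] M]

/-- The action of an element of the monoid on a module over the monoid algebra. -/
noncomputable def act (k : Type u) [Field k] (M : Type*) [AddCommGroup M] [Module k M]
    [Module k[adjoinConstants G] M] [IsScalarTower k k[adjoinConstants G] M]
    (s : adjoinConstants G) : M →ₗ[k] M where
  toFun v := (single s (1 : k)) • v
  map_add' := smul_add _
  map_smul' c v := by
    rw [RingHom.id_apply, ← algebraMap_smul k[adjoinConstants G] c v, smul_smul,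
      ← Algebra.commutes, ← smul_smul, algebraMap_smul]

theorem act_act (s t : adjoinConstants G) (v : M) : act k M s (act k M t v) = act k M (s * t) v := by
  change single s (1 : k) • single t (1 : k) • v = single (s * t) (1 : k) • v
  rw [smul_smul, single_mul_single, one_mul]

theorem act_one (v : M) : act k M (1 : adjoinConstants G) v = v :=
  one_smul k[adjoinConstants G] v

theorem act_perm_inv (g : G) (v : M) : act k M (perm g) (act k M (perm g⁻¹) v) = v := by
  rw [act_act, perm_mul_perm, mul_inv_cancel, perm_one, act_one]

theorem act_mem (p : Submodule k[adjoinConstants G] M) (s : adjoinConstants G) {v : M}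
    (hv : v ∈ p) : act k M s v ∈ p := p.smul_mem _ hv

/-- A linear map that commutes with the permutations and the constants is a module map. -/
noncomputable def linearMapOfComm {N : Type*} [AddCommGroup N] [Module k N]
    [Module k[adjoinConstants G] N] [IsScalarTower k k[adjoinConstants G] N] (f : M →ₗ[k] N)
    (hg : ∀ (g : G) v, f (act k M (perm g) v) = act k N (perm g) (f v))
    (hc : ∀ (x : X) v, f (act k M (const G x) v) = act k N (const G x) (f v)) :
    M →ₗ[k[adjoinConstants G]] N :=
  equivariantOfLinearOfComm f fun s v => by
    obtain ⟨g, rfl⟩ | ⟨x, rfl⟩ := eq_perm_or_const s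
    exacts [hg g v, hc x v]

theorem linearMapOfComm_apply {N : Type*} [AddCommGroup N] [Module k N]
    [Module k[adjoinConstants G] N] [IsScalarTower k k[adjoinConstants G] N] (f : M →ₗ[k] N)
    (hg : ∀ (g : G) v, f (act k M (perm g) v) = act k N (perm g) (f v))
    (hc : ∀ (x : X) v, f (act k M (const G x) v) = act k N (const G x) (f v)) (v : M) :
    linearMapOfComm f hg hc v = f v := rfl

/-- If the constants act by a common scalar, Maschke's averaging applies. -/
theorem exists_isCompl_of_const_scalar [CharZero k] [Finite X] (d : k)
    (hd : ∀ (x : X) (v : M), act k M (const G x) v = d • v)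
    (p : Submodule k[adjoinConstants G] M) : ∃ q, IsCompl p q := by
  classical
  have := Fintype.ofFinite G
  let p' : Submodule k M := p.restrictScalars k
  obtain ⟨π, hπ⟩ := p'.subtype.exists_leftInverse_of_injective p'.ker_subtype
  have hπ' (v : M) (hv : v ∈ p) : (π v : M) = v :=
    congrArg Subtype.val (LinearMap.congr_fun hπ ⟨v, hv⟩)
  have hcard : (Fintype.card G : k) ≠ 0 := by exact_mod_cast Fintype.card_ne_zero
  let F : M →ₗ[k] M := (Fintype.card G : k)⁻¹ • ∑ g : G,
    act k M (perm g) ∘ₗ p'.subtype ∘ₗ π ∘ₗ act k M (perm g⁻¹)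
  have hF (v : M) : F v = (Fintype.card G : k)⁻¹ • ∑ g : G,
      act k M (perm g) (π (act k M (perm g⁻¹) v) : M) := by
    simp [F, LinearMap.sum_apply]
  let f : M →ₗ[k[adjoinConstants G]] M := linearMapOfComm F
    (fun h v => by
      rw [hF, hF, map_smul, map_sum]
      congr 1
      refine (Equiv.sum_comp (Equiv.mulLeft h) _).symm.trans (Finset.sum_congr rfl fun g _ => ?_)
      rw [Equiv.coe_mulLeft, mul_inv_rev, act_act, perm_mul_perm, inv_mul_cancel_right, act_act,
        perm_mul_perm])
    (fun x v => by rw [hd, hd, map_smul])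
  have hfp (v : M) : f v ∈ p := by
    change F v ∈ p'
    rw [hF]
    exact p'.smul_mem _ (p'.sum_mem fun g _ => act_mem p _ (π _).2)
  refine ⟨_, LinearMap.isCompl_of_proj (f := f.codRestrict p hfp) fun v => Subtype.ext ?_⟩
  change F v = v
  rw [hF, Finset.sum_congr rfl fun g _ => by rw [hπ' _ (act_mem p _ v.2), act_perm_inv],
    Finset.sum_const, Finset.card_univ, ← Nat.cast_smul_eq_nsmul k, smul_smul,
    inv_mul_cancel₀ hcard, one_smul]

/-- If all constants act alike, they act as `0` or as the identity. -/
theorem const_scalar_of_indecomposable (hM : IsIndecomposableModule k[adjoinConstants G] M)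
    (h : ∀ (x y : X) (v : M), act k M (const G x) v = act k M (const G y) v) :
    ∃ d : k, ∀ (x : X) (v : M), act k M (const G x) v = d • v := by
  rcases isEmpty_or_nonempty X with hX | ⟨⟨x₀⟩⟩
  · exact ⟨0, fun x => isEmptyElim x⟩
  -- The action of `c_{x₀}` is linear over the algebra because `g c_{x₀} = c_{g x₀}` acts as
  -- `c_{x₀}` does.
  let f : M →ₗ[k[adjoinConstants G]] M := linearMapOfComm (act k M (const G x₀))
    (fun g v => by rw [act_act, act_act, const_mul, perm_mul_const, h])
    (fun x v => by rw [act_act, act_act, const_mul, const_mul, h])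
  have hf (v : M) : f v = act k M (const G x₀) v := rfl
  have hff (v : M) : f (f v) = f v := by rw [hf, hf, act_act, const_mul]
  have hc : IsCompl (LinearMap.range f) (LinearMap.ker f) := by
    rw [← LinearMap.ker_rangeRestrict f]
    refine LinearMap.isCompl_of_proj ?_
    rintro ⟨_, v, rfl⟩
    exact Subtype.ext (hff v)
  rcases hM.2 _ _ hc with h0 | h0
  · refine ⟨0, fun x v => ?_⟩
    rw [h x x₀, zero_smul, ← hf]
    exact (Submodule.mem_bot _).mp (h0 ▸ LinearMap.mem_range_self f v)
  · refine ⟨1, fun x v => ?_⟩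
    rw [h x x₀, one_smul, ← hf]
    exact LinearMap.ker_eq_bot.mp h0 (hff v)

/-! ### Modules on which constants differ -/

/-- A two-transitive family of matrix entries has one value on and one value off the diagonal. -/
theorem eq_ite_of_invariant [DecidableEq X] (hG : MulAction.IsMultiplyPretransitive G X 2)
    {Y : Type*} (t : X → X → Y) (ht : ∀ (g : G) x y, t (g • x) (g • y) = t x y)
    {x₀ y₀ : X} (h₀ : x₀ ≠ y₀) (x y : X) : t x y = if x = y then t x₀ x₀ else t x₀ y₀ := by
  rw [MulAction.is_two_pretransitive_iff] at hG
  split_ifs with h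
  · subst h
    have : Nontrivial X := ⟨x₀, y₀, h₀⟩
    obtain ⟨z, hz⟩ := exists_ne x
    obtain ⟨g, rfl, -⟩ := hG h₀ hz.symm
    exact ht g x₀ x₀
  · obtain ⟨g, rfl, rfl⟩ := hG h₀ h
    exact ht g x₀ y₀

/-- An equivariant family of functionals on which the constants act non-trivially. -/
theorem exists_equivariant_functional [CharZero k] [Finite X]
    {w : M} {x₁ y₁ : X} (hw : act k M (const G x₁) w ≠ act k M (const G y₁) w) :
    ∃ F : X → M →ₗ[k] k, (∀ (g : G) y v, F (g • y) (act k M (perm g) v) = F y v) ∧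
      ∃ x y, F y (act k M (const G x) w) ≠ F y (act k M (const G y) w) := by
  classical
  have := Fintype.ofFinite G
  have := Fintype.ofFinite X
  by_contra! hcon
  refine hw ?_
  have key (x₀ : X) (l : M →ₗ[k] k) : (Fintype.card X : k) * l (act k M (const G x₀) w) =
      ∑ x, l (act k M (const G x) w) := by
    -- The equivariant family generated by placing `l` at `x₀`; its member at `x₀` is `l` summed
    -- over the stabiliser `S`. If that member does not separate the `c_x w`, comparing its value at
    -- `c_{x₀} w` with the sum over all `x` gives `key`.
    let F : X → M →ₗ[k] k := fun y => ∑ g : G,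
      if g • x₀ = y then l ∘ₗ act k M (perm g⁻¹) else 0
    have hF (y : X) (v : M) : F y v = ∑ g : G,
        if g • x₀ = y then l (act k M (perm g⁻¹) v) else 0 := by
      simp only [F, LinearMap.sum_apply]
      refine Finset.sum_congr rfl fun g _ => ?_
      split_ifs <;> rfl
    have h1 := hcon F (fun h y v => by
      rw [hF, hF]
      refine (Equiv.sum_comp (Equiv.mulLeft h) _).symm.trans (Finset.sum_congr rfl fun g _ => ?_)
      simp only [Equiv.coe_mulLeft, mul_smul, smul_left_cancel_iff, mul_inv_rev, act_act,
        perm_mul_perm, inv_mul_cancel_right])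
    set S : Finset G := Finset.univ.filter fun g => g • x₀ = x₀ with hS
    have hFS (x : X) : F x₀ (act k M (const G x) w) =
        ∑ g ∈ S, l (act k M (const G (g⁻¹ • x)) w) := by
      rw [hF, Finset.sum_filter]
      simp only [act_act, perm_mul_const]
    have hSne : (S.card : k) ≠ 0 := by
      exact_mod_cast Finset.card_ne_zero_of_mem
        (Finset.mem_filter.mpr ⟨Finset.mem_univ 1, one_smul G x₀⟩)
    have h2 : F x₀ (act k M (const G x₀) w) = S.card * l (act k M (const G x₀) w) := by
      rw [hFS, Finset.sum_congr rfl (g := fun _ => l (act k M (const G x₀) w)), Finset.sum_const,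
        nsmul_eq_mul]
      intro g hg
      rw [inv_smul_eq_iff.mpr (Finset.mem_filter.mp hg).2.symm]
    have h3 : ∑ x, F x₀ (act k M (const G x) w) =
        S.card * ∑ x, l (act k M (const G x) w) := by
      simp only [hFS]
      rw [Finset.sum_comm, Finset.sum_congr rfl
        (g := fun _ => ∑ x, l (act k M (const G x) w)), Finset.sum_const, nsmul_eq_mul]
      intro g _
      exact Equiv.sum_comp (MulAction.toPerm g⁻¹) fun x => l (act k M (const G x) w)
    refine mul_left_cancel₀ hSne ?_
    rw [← h3, Finset.sum_congr rfl fun x _ => h1 x x₀, h2, Finset.sum_const, Finset.card_univ,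
      nsmul_eq_mul]
    ring
  have hn : (Fintype.card X : k) ≠ 0 := by
    have : Nonempty X := ⟨x₁⟩
    exact_mod_cast Fintype.card_ne_zero
  -- The right side of `key` does not depend on `x₀`, and functionals separate points.
  rw [← sub_eq_zero, ← Module.forall_dual_apply_eq_zero_iff k]
  intro l
  rw [map_sub, sub_eq_zero]
  exact mul_left_cancel₀ hn ((key x₁ l).trans (key y₁ l).symm)

/-- The left ideal spanned by the constants. -/
noncomputable def constIdeal (k : Type u) [Field k] (G : Subgroup (Equiv.Perm X)) :
    Submodule k[adjoinConstants G] k[adjoinConstants G] :=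
  Submodule.span _ (Set.range fun x => single (const G x) (1 : k))

/-- A module map to the monoid algebra that is a nonzero scalar on the constants through `w`. -/
theorem exists_map_to_constIdeal [CharZero k] [Finite X]
    (hG : MulAction.IsMultiplyPretransitive G X 2)
    {w : M} {x₁ y₁ : X} (hw : act k M (const G x₁) w ≠ act k M (const G y₁) w) :
    ∃ f : M →ₗ[k[adjoinConstants G]] k[adjoinConstants G], (∀ v, f v ∈ constIdeal k G) ∧
      ∃ a : k, a ≠ 0 ∧ ∀ x, f (act k M (const G x) w) = a • single (const G x) 1 := by
  classical
  have := Fintype.ofFinite X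
  have hn : (Fintype.card X : k) ≠ 0 := by
    have : Nonempty X := ⟨x₁⟩
    exact_mod_cast Fintype.card_ne_zero
  obtain ⟨F, hF, x₀, y₀, hne⟩ := exists_equivariant_functional hw
  have h₀ : y₀ ≠ x₀ := by
    rintro rfl
    exact hne rfl
  -- Diagonal minus off-diagonal entry of the invariant matrix `F y (c_x v)`.
  let l : M →ₗ[k] k :=
    F y₀ ∘ₗ act k M (const G y₀) - F x₀ ∘ₗ act k M (const G y₀)
  have hFc (v : M) (x y : X) : F y (act k M (const G x) v) =
      if x = y then F y₀ (act k M (const G y₀) v) else F x₀ (act k M (const G y₀) v) :=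
    eq_ite_of_invariant hG (fun x y => F y (act k M (const G x) v)) (fun g x y => by
      rw [← perm_mul_const, ← act_act, hF]) h₀ x y
  have hl (v : M) : l v = F y₀ (act k M (const G y₀) v) - F x₀ (act k M (const G y₀) v) := rfl
  have hls (s : adjoinConstants G) (v : M) : l (act k M s v) = l v := by
    simp only [hl, act_act, const_mul]
  -- Removing the mean and adding `l / |X|` turns the matrix into `l v` times the identity and makes
  -- the `E y` sum to `l`; the latter gives compatibility with the constants.
  let E : X → M →ₗ[k] k := fun y =>
    F y - (Fintype.card X : k)⁻¹ • ∑ z, F z + (Fintype.card X : k)⁻¹ • l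
  have hE (y : X) (v : M) : E y v =
      F y v - (Fintype.card X : k)⁻¹ * ∑ z, F z v + (Fintype.card X : k)⁻¹ * l v := by
    simp [E, LinearMap.sum_apply]
  have hEg (g : G) (y : X) (v : M) : E (g • y) (act k M (perm g) v) = E y v := by
    rw [hE, hE, hF, hls]
    congr 3
    rw [← Equiv.sum_comp (MulAction.toPerm g)]
    exact Finset.sum_congr rfl fun z _ => hF g z v
  have hEc (x y : X) (v : M) : E y (act k M (const G x) v) = if x = y then l v else 0 := by
    have hs : ∑ z, F z (act k M (const G x) v) =
        l v + Fintype.card X * F x₀ (act k M (const G y₀) v) := by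
      rw [Finset.sum_congr rfl (g := fun z => (if x = z then l v else 0) +
        F x₀ (act k M (const G y₀) v)), Finset.sum_add_distrib, Finset.sum_ite_eq,
        if_pos (Finset.mem_univ _), Finset.sum_const, Finset.card_univ, nsmul_eq_mul]
      intro z _
      rw [hFc, hl]
      split_ifs <;> ring
    rw [hE, hs, hls, hFc, hl]
    split_ifs <;> field_simp <;> ring
  have hEs (v : M) : ∑ y, E y v = l v := by
    simp only [hE]
    rw [Finset.sum_add_distrib, Finset.sum_sub_distrib, Finset.sum_const, Finset.sum_const,
      Finset.card_univ, nsmul_eq_mul, nsmul_eq_mul]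
    field_simp
    ring
  let f : M →ₗ[k] k[adjoinConstants G] := ∑ y, (E y).smulRight (single (const G y) (1 : k))
  have hf (v : M) : f v = ∑ y, E y v • single (const G y) (1 : k) := by
    simp [f, LinearMap.sum_apply]
  have hfc (x : X) (v : M) : f (act k M (const G x) v) = l v • single (const G x) (1 : k) := by
    rw [hf]
    simp only [hEc, ite_smul, zero_smul]
    rw [Finset.sum_ite_eq, if_pos (Finset.mem_univ _)]
  have hact (s t : adjoinConstants G) :
      act k k[adjoinConstants G] s (single t (1 : k)) = single (s * t) 1 := by
    change single s (1 : k) * single t 1 = _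
    rw [single_mul_single, one_mul]
  refine ⟨linearMapOfComm f (fun g v => ?_) (fun x v => ?_), fun v => ?_, l w, ?_, fun x => hfc x w⟩
  · rw [hf, hf, map_sum, ← Equiv.sum_comp (MulAction.toPerm g)]
    refine Finset.sum_congr rfl fun y _ => ?_
    rw [map_smul, hact, perm_mul_const, MulAction.toPerm_apply, hEg]
  · rw [hfc, hf, map_sum, ← hEs, Finset.sum_smul]
    refine Finset.sum_congr rfl fun y _ => ?_
    rw [map_smul, hact, const_mul]
  · rw [linearMapOfComm_apply, hf]
    exact Submodule.sum_mem _ fun y _ => Submodule.smul_of_tower_mem _ _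
      (Submodule.subset_span ⟨y, rfl⟩)
  · rw [hl, sub_ne_zero]
    intro h
    apply hne
    rw [hFc, hFc, if_neg h₀.symm, if_pos rfl, h]

/-- The map `j` is a section of `f'`, so `M` is the direct sum of the range of `j` and the kernel of
`f'`; the range is nonzero, so the kernel vanishes. -/
theorem nonempty_equiv_constIdeal [CharZero k] [Finite X]
    (hG : MulAction.IsMultiplyPretransitive G X 2)
    (hM : IsIndecomposableModule k[adjoinConstants G] M)
    {w : M} {x₁ y₁ : X} (hw : act k M (const G x₁) w ≠ act k M (const G y₁) w) :
    Nonempty (M ≃ₗ[k[adjoinConstants G]] constIdeal k G) := by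
  obtain ⟨f, hf, a, ha, hfa⟩ := exists_map_to_constIdeal hG hw
  have hinv (x : X) : f (act k M (const G x) (a⁻¹ • w)) = single (const G x) 1 := by
    rw [map_smul, LinearMap.map_smul_of_tower, hfa, smul_smul, inv_mul_cancel₀ ha, one_smul]
  let j : constIdeal k G →ₗ[k[adjoinConstants G]] M :=
    LinearMap.toSpanSingleton _ M (a⁻¹ • w) ∘ₗ (constIdeal k G).subtype
  let f' : M →ₗ[k[adjoinConstants G]] constIdeal k G := f.codRestrict _ hf
  -- Enough on generators, where the factor `a⁻¹` cancels the scalar `a`.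
  have hfj (b : constIdeal k G) : f' (j b) = b := by
    refine Subtype.ext ?_
    change f ((b : k[adjoinConstants G]) • (a⁻¹ • w)) = b
    obtain ⟨b, hb⟩ := b
    induction hb using Submodule.span_induction with
    | mem b hb =>
      obtain ⟨x, rfl⟩ := hb
      exact hinv x
    | zero => simp
    | add b c _ _ hb hc => simpa only [add_smul, map_add] using congrArg₂ (· + ·) hb hc
    | smul r b _ hb => simpa only [smul_eq_mul, mul_smul, map_smul] using congrArg (r • ·) hb
  have hc : IsCompl (LinearMap.range j) (LinearMap.ker f') := by
    have := LinearMap.isCompl_of_proj (f := j.rangeRestrict ∘ₗ f') (by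
      rintro ⟨_, b, rfl⟩
      exact Subtype.ext (congrArg j (hfj b)))
    rwa [LinearMap.ker_comp_of_ker_eq_bot] at this
    rw [LinearMap.ker_rangeRestrict]
    exact LinearMap.ker_eq_bot.mpr (Function.LeftInverse.injective hfj)
  have hker : LinearMap.ker f' = ⊥ := by
    refine (hM.2 _ _ hc).resolve_left fun h0 => ?_
    have hs : single (const G x₁) (1 : k) ∈ constIdeal k G := Submodule.subset_span ⟨x₁, rfl⟩
    have hj0 : j ⟨_, hs⟩ = 0 := (Submodule.mem_bot _).mp (h0 ▸ LinearMap.mem_range_self j _)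
    have := congrArg Subtype.val (hfj ⟨_, hs⟩)
    rw [hj0, map_zero] at this
    exact one_ne_zero (single_eq_zero.mp this.symm)
  exact ⟨LinearEquiv.ofBijective f' ⟨LinearMap.ker_eq_bot.mp hker,
    Function.RightInverse.surjective hfj⟩⟩

end adjoinConstants

/-! ### The two cases combined -/

open adjoinConstants

theorem mainTheorem7 {k : Type*} [Field k] [IsAlgClosed k] [CharZero k]
    {X : Type*} [Finite X] (G : Subgroup (Equiv.Perm X))
    (hG : MulAction.IsMultiplyPretransitive G X 2) :
    IsOfFiniteRepresentationType (MonoidAlgebra k (adjoinConstants G)) := by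
  have : Finite (Function.End X) := inferInstanceAs (Finite (X → X))
  have : IsArtinianRing k[adjoinConstants G] := .of_finite k _
  obtain ⟨L, hL⟩ := IsArtinianRing.exists_list_simple k[adjoinConstants G]
  refine .of_list (ModuleCat.of _ (constIdeal k G) :: L) fun M _ _ hM => ?_
  let _ : Module k M := Module.compHom M (algebraMap k k[adjoinConstants G])
  have : IsScalarTower k k[adjoinConstants G] M := ⟨fun c a v => by
    rw [Algebra.smul_def, mul_smul]
    rfl⟩
  by_cases h : ∀ (x y : X) (v : M), act k M (const G x) v = act k M (const G y) v
  · obtain ⟨d, hd⟩ := const_scalar_of_indecomposable hM h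
    obtain ⟨N, hN, e⟩ := hL M (hM.isSimpleModule (exists_isCompl_of_const_scalar d hd))
    exact ⟨N, List.mem_cons_of_mem _ hN, e⟩
  · push Not at h
    obtain ⟨x, y, w, hw⟩ := h
    exact ⟨_, List.mem_cons_self, nonempty_equiv_constIdeal hG hM hw⟩
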